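/- For a set $U$ let $D(U)$ be the set of finitely supported functions $p:U\to\mathbb{R}_{\ge 0}$ with $\sum_u p(u)=1$; for a simplicial set $Y$ let $DY$ be the simplicial set with $(DY)_n=D(Y_n)$ whose structure maps are the push-forwards along those of $Y$. Let $N\mathbb{Z}_2$ be the nerve of $\mathbb{Z}_2$: $(N\mathbb{Z}_2)_n=\mathbb{Z}_2^n$, where $d_0$ and $d_n$ drop the first and last entry, $d_i$ ($0<i<n$) adds the $i$-th and $(i+1)$-st entries, and degeneracies insert $0$. A simplicial probability distribution on $(X,N\mathbb{Z}_2)$ is a simplicial map $p:X\to DN\mathbb{Z}_2$. It is *noncontextual* if there is $\lambda\in D(\mathrm{Hom}(X,N\mathbb{Z}_2))$ with $p_\sigma(\theta)=\sum_{r:\,r_\sigma=\theta}\lambda(r)$ for all simplices $\sigma$ of $X$ and all $\theta$, and *contextual* otherwise. It *extends* along a simplicial map $f:X\to X'$ if $p=q\circ f$ for some simplicial probability distribution $q$ on $(X',N\mathbb{Z}_2)$. Let $T^\circ$ be the simplicial set generated by the $2$-simplices $\sigma_{y_0x_0},\sigma_{y_0x_1},\sigma_{x_0y_1},\sigma_{x_1y_1}$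 with the relations $$d_0\sigma_{y_0x_0}=d_2\sigma_{x_0y_1},\quad d_0\sigma_{y_0x_1}=d_2\sigma_{x_1y_1},\quad d_2\sigma_{y_0x_0}=d_2\sigma_{y_0x_1},\quad d_0\sigma_{x_0y_1}=d_0\sigma_{x_1y_1}.$$ Let $T$ be the torus obtained by adding two more generating $2$-simplices $\sigma_+,\sigma_-$ (the diamond) with the relations $$d_2\sigma_+=d_1\sigma_{y_0x_0},\quad d_0\sigma_+=d_1\sigma_{x_1y_1},\quad d_2\sigma_-=d_1\sigma_{y_0x_1},\quad d_0\sigma_-=d_1\sigma_{x_0y_1},\quad d_1\sigma_+=d_1\sigma_-,$$ let $\iota:T^\circ\to T$ be the canonical map, and let $\iota(T^\circ)\subset T$ be its image, the subspace of $T$ generated by the four original triangles (it differs from $T^\circ$ only in that the two endpoints of each of the edges $x_0,x_1$ are identified, so that it is the torus with the open diamond removed). (1) A simplicial probability distribution on $(T^\circ,N\mathbb{Z}_2)$ extends to $T$ along $\iota$ if and only if it is noncontextual. (2) There is a unique simplicial probability distribution $p$ on $(T^\circ,N\mathbb{Z}_2)$ (the Popescu–Rohrlich box) such that $p_{\sigma_{y_0x_0}}(a,b)=\tfrac12$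 if $a+b=1$ and $0$ otherwise, and, for each of the other three generating triangles $\sigma$, $p_\sigma(a,b)=\tfrac12$ if $a+b=0$ and $0$ otherwise. It does not extend to $T$, and it is contextual. The statements (1) and (2) hold likewise with $T^\circ$ and $\iota$ replaced by the subspace $\iota(T^\circ)$ and its inclusion into $T$. -/

import Mathlib

open CategoryTheory Simplicial Opposite Convexity
open scoped NNReal

/-! ## Distributions, simplicial distributions and contextuality -/

/-- The space `D Y` of probability distributions on a simplicial set `Y`: an `n`-simplex is a
finitely supported probability distribution (with weights in `ℝ≥0`) on the set of `n`-simplices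
of `Y`, and the structure maps are push-forwards along those of `Y`. -/
noncomputable def distSpace (Y : SSet.{0}) : SSet.{0} where
  obj n := StdSimplex ℝ≥0 (Y.obj n)
  map f := ↾fun p => p.map (Y.map f)
  map_id n := ConcreteCategory.hom_ext _ _ fun p => by
    rw [Y.map_id]
    exact StdSimplex.map_id p
  map_comp f g := ConcreteCategory.hom_ext _ _ fun p => by
    rw [Y.map_comp]
    exact StdSimplex.map_comp p (Y.map f) (Y.map g)

/-- Simplicial probability distributions on the scenario `(X, Y)`. -/
abbrev SimplicialDist (X Y : SSet.{0}) : Type := X ⟶ distSpace Y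

/-- The simplicial distribution of a classical distribution `∑ λ(r) δ^r` on outcome maps
`r : X ⟶ Y`; it sends `σ` to `θ ↦ ∑_{r : r_σ = θ} λ(r)`. -/
noncomputable def classicalToSimplicial {X Y : SSet.{0}} (d : StdSimplex ℝ≥0 (X ⟶ Y)) :
    SimplicialDist X Y where
  app n := ↾fun σ => d.map fun r => r.app n σ
  naturality m n f := ConcreteCategory.hom_ext _ _ fun σ => by
    refine Eq.trans ?_ (StdSimplex.map_map d _ _).symm
    exact congrArg (StdSimplex.map · d) (funext fun r => NatTrans.naturality_apply r f σ)

/-- `p` is noncontextual if it comes from a classical distribution. -/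
def Noncontextual {X Y : SSet.{0}} (p : SimplicialDist X Y) : Prop :=
  ∃ d : StdSimplex ℝ≥0 (X ⟶ Y), classicalToSimplicial d = p

/-- `p` is contextual if it is not noncontextual. -/
def Contextual {X Y : SSet.{0}} (p : SimplicialDist X Y) : Prop := ¬ Noncontextual p

/-- `p` on `(Z, Y)` extends along a map `f : Z ⟶ X` of measurement spaces if it is the pullback
of a simplicial distribution on `(X, Y)`. -/
def ExtendsAlong {Z X Y : SSet.{0}} (f : Z ⟶ X) (p : SimplicialDist Z Y) : Prop :=
  ∃ q : SimplicialDist X Y, f ≫ q = p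

/-! ## The nerve of `ℤ_d` -/

theorem partialSum_sub {A : Type} [AddCommGroup A] {m : ℕ} (P : Fin (m + 1) → A)
    (j : Fin (m + 1)) :
    Fin.partialSum (fun k : Fin m => P k.succ - P k.castSucc) j = P j - P 0 := by
  induction j using Fin.induction with
  | zero => simp
  | succ k ih => rw [Fin.partialSum_succ, ih]; abel

/-- The nerve space `N ℤ_d`: its `n`-simplices are tuples `(a_1, …, a_n)`, where `a_k` labels the
edge from vertex `k - 1` to vertex `k` and hence `a_{i+1} + ⋯ + a_j` labels the edge from `i` to
`j`; the structure maps restrict this edge labelling. -/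
def nerveZMod (d : ℕ) : SSet.{0} where
  obj n := Fin n.unop.len → ZMod d
  map f := ↾fun a k =>
    Fin.partialSum a (f.unop.toOrderHom k.succ) - Fin.partialSum a (f.unop.toOrderHom k.castSucc)
  map_id n := ConcreteCategory.hom_ext _ _ fun a => funext fun k => by
    change Fin.partialSum a k.succ - Fin.partialSum a k.castSucc = a k
    simp [Fin.partialSum_succ]
  map_comp f g := ConcreteCategory.hom_ext _ _ fun a => funext fun k => by
    have h := partialSum_sub fun l => Fin.partialSum a (f.unop.toOrderHom l)
    refine Eq.trans ?_ (congrArg₂ (· - ·) (h (g.unop.toOrderHom k.succ))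
      (h (g.unop.toOrderHom k.castSucc))).symm
    simp

theorem nerveZMod_δ_zero (d n : ℕ) (a : Fin (n + 1) → ZMod d) :
    (nerveZMod d).δ (n := n) 0 a = Fin.tail a := by
  funext k
  change Fin.partialSum a (Fin.succAbove 0 k.succ) - Fin.partialSum a (Fin.succAbove 0 k.castSucc)
    = a k.succ
  rw [Fin.succAbove_zero, Fin.partialSum_succ, Fin.succ_castSucc]
  abel

theorem nerveZMod_δ_succ (d n : ℕ) (i : Fin (n + 1)) (a : Fin (n + 1) → ZMod d) :
    (nerveZMod d).δ (n := n) i.succ a = Fin.contractNth i (· + ·) a := by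
  funext k
  change Fin.partialSum a (i.succ.succAbove k.succ) -
    Fin.partialSum a (i.succ.succAbove k.castSucc) = _
  have h := fun l => congrFun (Fin.partialSum_contractNth (g := a) (a := i)) l
  simp only [Function.comp_apply] at h
  rw [← h, ← h, Fin.partialSum_succ]
  abel

theorem nerveZMod_σ (d n : ℕ) (j : Fin (n + 1)) (a : Fin n → ZMod d) :
    (nerveZMod d).σ (n := n) j a = j.insertNth (α := fun _ => ZMod d) 0 a := by
  funext k
  change Fin.partialSum a (j.predAbove k.succ) - Fin.partialSum a (j.predAbove k.castSucc) = _
  rcases Fin.eq_self_or_eq_succAbove j k with rfl | ⟨l, rfl⟩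
  · simp
  · rw [Fin.insertNth_apply_succAbove]
    rcases lt_or_ge l.castSucc j with h | h
    · rw [Fin.succAbove_of_castSucc_lt _ _ h, Fin.predAbove_castSucc_of_le _ _ h.le,
        Fin.succ_castSucc, Fin.predAbove_castSucc_of_le _ _ (Fin.castSucc_lt_iff_succ_le.mp h),
        Fin.partialSum_succ]
      abel
    · rw [Fin.succAbove_of_le_castSucc _ _ h, ← Fin.succ_castSucc,
        Fin.predAbove_succ_of_le _ _ h,
        Fin.predAbove_succ_of_le _ _ (h.trans (Fin.castSucc_lt_succ).le), Fin.partialSum_succ]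
      abel

/-! ## Simplicial sets obtained by gluing triangles along edges -/

/-- The relation `d_i σ_left = d_j σ_right` between edges of triangles indexed by `G`. -/
structure EdgeRelation (G : Type) where
  left : G
  i : Fin 3
  right : G
  j : Fin 3

/-- The simplicial set generated by triangles `σ_g`, `g : G`, subject to the relations `R`: the
quotient of the disjoint union of copies of `Δ[2]` that identifies, for each relation in `R`, the
corresponding two edges. -/
def glueTriangles {G : Type} (R : Set (EdgeRelation G)) : SSet.{0} where
  obj n := Quot fun s t : G × (n.unop ⟶ ⦋2⦌) =>
    ∃ ρ ∈ R, ∃ u : n.unop ⟶ ⦋1⦌,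
      s = (ρ.left, u ≫ SimplexCategory.δ ρ.i) ∧ t = (ρ.right, u ≫ SimplexCategory.δ ρ.j)
  map f := ↾Quot.map (fun s => (s.1, f.unop ≫ s.2)) (by
    rintro _ _ ⟨ρ, hρ, u, rfl, rfl⟩
    exact ⟨ρ, hρ, f.unop ≫ u, by simp, by simp⟩)
  map_id n := by ext ⟨s⟩; simp [Quot.map]
  map_comp f g := by ext ⟨s⟩; simp [Quot.map]

/-- The generating triangle `σ_g`. -/
def triangle {G : Type} (R : Set (EdgeRelation G)) (g : G) : (glueTriangles R) _⦋2⦌ :=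
  Quot.mk _ (g, 𝟙 ⦋2⦌)

theorem δ_triangle {G : Type} {R : Set (EdgeRelation G)} {ρ : EdgeRelation G} (hρ : ρ ∈ R) :
    (glueTriangles R).δ ρ.i (triangle R ρ.left) = (glueTriangles R).δ ρ.j (triangle R ρ.right) :=
  Quot.sound ⟨ρ, hρ, 𝟙 _, by simp, by simp⟩

/-! ## The CHSH scenario -/

/-- The four contexts of the CHSH scenario; in the triangle `σ_{uv}` the face `d_2` is the
measurement `u`, the face `d_0` is `v`, and the face `d_1` is `u ⊕ v`. -/
inductive CHSHContext
  | y0x0 | y0x1 | x0y1 | x1y1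

/-- The four triangles of the CHSH scenario, with the two triangles of the removed diamond:
`plus` for the context `(x_0 ⊕ y_0, x_1 ⊕ y_1)` and `minus` for `(x_1 ⊕ y_0, x_0 ⊕ y_1)`. -/
inductive TorusContext
  | chsh (c : CHSHContext) | plus | minus

open CHSHContext TorusContext

/-- The identifications of the measurements `x_0`, `x_1`, `y_0`, `y_1`. -/
def chshRelations : Set (EdgeRelation CHSHContext) :=
  { ⟨y0x0, 0, x0y1, 2⟩,
    ⟨y0x1, 0, x1y1, 2⟩,
    ⟨y0x0, 2, y0x1, 2⟩,
    ⟨x0y1, 0, x1y1, 0⟩ }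

/-- The identifications in the torus: those of the CHSH scenario, the four edges `x_i ⊕ y_j` of
the diamond, and the common `d_1`-face of the two triangles of the diamond. -/
def torusRelations : Set (EdgeRelation TorusContext) :=
  { ⟨chsh y0x0, 0, chsh x0y1, 2⟩,
    ⟨chsh y0x1, 0, chsh x1y1, 2⟩,
    ⟨chsh y0x0, 2, chsh y0x1, 2⟩,
    ⟨chsh x0y1, 0, chsh x1y1, 0⟩,
    ⟨plus, 2, chsh y0x0, 1⟩,
    ⟨plus, 0, chsh x1y1, 1⟩,
    ⟨minus, 2, chsh y0x1, 1⟩,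
    ⟨minus, 0, chsh x0y1, 1⟩,
    ⟨plus, 1, minus, 1⟩ }

/-- The CHSH measurement space: four triangles glued along `x_0`, `x_1`, `y_0`, `y_1`. -/
def chshSpace : SSet.{0} := glueTriangles chshRelations

/-- The torus, triangulated by six triangles. -/
def torus : SSet.{0} := glueTriangles torusRelations

/-- The canonical map from the CHSH measurement space to the torus. -/
def chshToTorus : chshSpace ⟶ torus where
  app n := ↾Quot.map (fun s => (chsh s.1, s.2)) (by
    rintro _ _ ⟨ρ, hρ, u, rfl, rfl⟩
    refine ⟨⟨chsh ρ.left, ρ.i, chsh ρ.right, ρ.j⟩, ?_, u, rfl, rfl⟩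
    rcases hρ with rfl | rfl | rfl | rfl <;> simp [torusRelations])
  naturality m n f := by ext ⟨s⟩; rfl

/-- The punctured torus as a subspace of the torus: the subspace generated by the four triangles
of the CHSH scenario, that is, the torus without the two triangles of the diamond and without
their common edge. -/
def puncturedTorus : torus.Subcomplex := SSet.Subcomplex.range chshToTorus

/-- The four triangles of the CHSH measurement space. -/
def chshTriangle (c : CHSHContext) : chshSpace _⦋2⦌ := triangle chshRelations c

/-- The four triangles of the punctured torus. -/
def puncturedTriangle (c : CHSHContext) : (puncturedTorus : SSet.{0}) _⦋2⦌ :=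
  (SSet.Subcomplex.toRange chshToTorus).app _ (chshTriangle c)

/-- The probability that a distribution on the `2`-simplices of `N ℤ_2` gives to `(a, b)`. -/
noncomputable def prob (p : (distSpace (nerveZMod 2)) _⦋2⦌) (a b : ZMod 2) : ℝ≥0 :=
  StdSimplex.weights (M := Fin 2 → ZMod 2) p ![a, b]

/-- `p`, on a space `X` with a triangle for each of the four contexts, is the Popescu–Rohrlich
box: on `(y_0, x_0)` the two outcomes are uniformly random with sum `1`, and on each of the other
three contexts they are uniformly random with sum `0`. -/
def IsPRBox {X : SSet.{0}} (tri : CHSHContext → X _⦋2⦌)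
    (p : SimplicialDist X (nerveZMod 2)) : Prop :=
  (∀ a b, prob (p.app _ (tri y0x0)) a b = if a + b = 1 then 1 / 2 else 0) ∧
  (∀ a b, prob (p.app _ (tri y0x1)) a b = if a + b = 0 then 1 / 2 else 0) ∧
  (∀ a b, prob (p.app _ (tri x0y1)) a b = if a + b = 0 then 1 / 2 else 0) ∧
  (∀ a b, prob (p.app _ (tri x1y1)) a b = if a + b = 0 then 1 / 2 else 0)

/-!
The nerve of `ℤ_2` has a single vertex, so an outcome map on the CHSH measurement space is a choice
of outcomes `y₀, x₀, x₁, y₁`, and every such choice fills the diamond, by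
`(y₀ + x₀) + (x₁ + y₁) = (y₀ + x₁) + (x₀ + y₁)`. Outcome maps thus extend to the torus
(`exists_chshToTorus_comp_eq`), and with them all noncontextual distributions.

Conversely, write `a, b, c, d` for the probabilities of the outcome `1` on the edges `x_i ⊕ y_j` of
the contexts `y0x0`, `y0x1`, `x0y1`, `x1y1`. A triangle of distributions on the nerve forces the
probabilities of `1` on its three edges to satisfy the triangle inequalities and to have sum at most
`2` (`ParityTriangle`). The diamond of the torus is a pair of such triangles, `(a, d, v)` and
`(b, c, v)`, with the common side `v`. They give the CHSH inequalities between `a, b, c, d`, which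
say that the quadrilateral can be cut along its other diagonal as well: some `w` makes `(a, b, w)`
and `(c, d, w)` such triangles (`ParityTriangle.exists_diagonal`). With `w` as the probability of
`x₀ ≠ x₁`, the two halves become distributions of `(y₀, x₀, x₁)` and `(x₀, x₁, y₁)` with a common
marginal on `(x₀, x₁)` (`exists_triple`), and these are glued by making `y₀` and `y₁` conditionally
independent. This is Fine's theorem (`exists_joint_of_parityTriangle`).

The punctured torus is a quotient of the CHSH measurement space, so its distributions are
distributions on the latter, and both parts reduce to it, except for the existence of the
Popescu–Rohrlich box: it has to be constant on the fibres of the quotient map. As its edges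
`x_i ⊕ y_j` are deterministic, it extends to a labelling of all simplices of the torus that respects
the identifications without being simplicial (`prTorusLabel`), and this is enough.
-/

/-! ### Maps out of glued triangles -/

theorem glueTriangles_hom_ext {G : Type} {R : Set (EdgeRelation G)} {Y : SSet.{0}}
    {f f' : glueTriangles R ⟶ Y}
    (h : ∀ g, f.app (op ⦋2⦌) (triangle R g) = f'.app (op ⦋2⦌) (triangle R g)) : f = f' := by
  ext n s
  induction s using Quot.ind with
  | mk s =>
    obtain ⟨g, u⟩ := s
    have e : (Quot.mk _ (g, u) : (glueTriangles R).obj n)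
        = (glueTriangles R).map u.op (triangle R g) :=
      congrArg (fun v => Quot.mk _ (g, v)) (Category.comp_id u).symm
    rw [e]
    exact (NatTrans.naturality_apply f u.op (triangle R g)).trans
      ((congrArg (Y.map u.op) (h g)).trans
        (NatTrans.naturality_apply f' u.op (triangle R g)).symm)

theorem map_comp_δ {Y : SSet.{0}} {n : SimplexCategoryᵒᵖ} (u : n.unop ⟶ ⦋1⦌) (i : Fin 3)
    (t : Y _⦋2⦌) :
    Y.map (u ≫ SimplexCategory.δ i).op t = Y.map u.op (Y.δ i t) := by
  rw [op_comp, Y.map_comp]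
  rfl

/-- The map out of `glueTriangles R` that sends `σ_g` to `t g`, for triangles `t g` whose edges
match as `R` prescribes. -/
def glueTrianglesDesc {G : Type} {R : Set (EdgeRelation G)} {Y : SSet.{0}} (t : G → Y _⦋2⦌)
    (h : ∀ ρ ∈ R, Y.δ ρ.i (t ρ.left) = Y.δ ρ.j (t ρ.right)) : glueTriangles R ⟶ Y where
  app n := ↾Quot.lift (fun s : G × (n.unop ⟶ ⦋2⦌) => Y.map s.2.op (t s.1)) (by
    rintro _ _ ⟨ρ, hρ, u, rfl, rfl⟩
    change Y.map _ _ = Y.map _ _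
    rw [map_comp_δ, map_comp_δ, h ρ hρ])
  naturality m n f := by
    ext ⟨s⟩
    change Y.map (f.unop ≫ s.2).op (t s.1) = Y.map f (Y.map s.2.op (t s.1))
    rw [op_comp, Y.map_comp]
    rfl

theorem glueTrianglesDesc_triangle {G : Type} {R : Set (EdgeRelation G)} {Y : SSet.{0}}
    (t : G → Y _⦋2⦌) (h : ∀ ρ ∈ R, Y.δ ρ.i (t ρ.left) = Y.δ ρ.j (t ρ.right)) (g : G) :
    (glueTrianglesDesc t h).app (op ⦋2⦌) (triangle R g) = t g := by
  change Y.map (𝟙 _) (t g) = t g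
  rw [Y.map_id]
  rfl

theorem δ_app_triangle {G : Type} {R : Set (EdgeRelation G)} {Y : SSet.{0}}
    (f : glueTriangles R ⟶ Y) {ρ : EdgeRelation G} (hρ : ρ ∈ R) :
    Y.δ ρ.i (f.app (op ⦋2⦌) (triangle R ρ.left)) =
      Y.δ ρ.j (f.app (op ⦋2⦌) (triangle R ρ.right)) := by
  have h (i : Fin 3) (s) : Y.δ i (f.app (op ⦋2⦌) s) = f.app (op ⦋1⦌) ((glueTriangles R).δ i s) :=
    (NatTrans.naturality_apply f (SimplexCategory.δ i).op s).symm
  rw [h, h, δ_triangle hρ]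

/-! ### Triangles of distributions on the nerve of `ℤ_2` -/

theorem nerveZMod_δ_pair (d : ℕ) (a b : ZMod d) :
    (nerveZMod d).δ (n := 1) 0 ![a, b] = ![b] ∧ (nerveZMod d).δ (n := 1) 1 ![a, b] = ![a + b] ∧
      (nerveZMod d).δ (n := 1) 2 ![a, b] = ![a] := by
  refine ⟨(nerveZMod_δ_zero d 1 _).trans rfl, (nerveZMod_δ_succ d 1 0 _).trans ?_,
    (nerveZMod_δ_succ d 1 1 _).trans ?_⟩ <;>
  · funext k
    fin_cases k
    simp [Fin.contractNth]

theorem Convexity.StdSimplex.map_weights_apply {M N : Type*} [Fintype M] [DecidableEq N]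
    (p : StdSimplex ℝ≥0 M) (g : M → N) (x : N) :
    (p.map g).weights x = ∑ m, if g m = x then p.weights m else 0 := by
  rw [StdSimplex.weights_map, Finsupp.mapDomain, Finsupp.sum_fintype _ _ (by simp),
    Finsupp.finsetSum_apply]
  simp [Finsupp.single_apply]

theorem sum_pair {M : Type*} [AddCommMonoid M] (F : (Fin 2 → ZMod 2) → M) :
    ∑ x, F x = F ![0, 0] + F ![0, 1] + (F ![1, 0] + F ![1, 1]) := by
  rw [← Fintype.sum_equiv (finTwoArrowEquiv (ZMod 2)).symm (fun x => F ![x.1, x.2]) F (by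
    rintro ⟨a, b⟩; rfl), Fintype.sum_prod_type]
  change ∑ x : Fin 2, ∑ y : Fin 2, F ![(x : ZMod 2), (y : ZMod 2)] = _
  rw [Fin.sum_univ_two, Fin.sum_univ_two, Fin.sum_univ_two]
  rfl

theorem sum_prob (t : (distSpace (nerveZMod 2)) _⦋2⦌) :
    prob t 0 0 + prob t 0 1 + (prob t 1 0 + prob t 1 1) = 1 := by
  have h := StdSimplex.total (R := ℝ≥0) (M := Fin 2 → ZMod 2) t
  rw [Finsupp.sum_fintype _ _ (by simp), sum_pair] at h
  exact h

theorem zmod_two_one_add_one : (1 : ZMod 2) + 1 = 0 := rfl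

theorem zmod_two_cases (a : ZMod 2) : a = 0 ∨ a = 1 := by
  revert a; decide

theorem dist_two_ext {t t' : (distSpace (nerveZMod 2)) _⦋2⦌}
    (h : ∀ a b, prob t a b = prob t' a b) : t = t' := by
  refine StdSimplex.ext (R := ℝ≥0) (M := Fin 2 → ZMod 2) (Finsupp.ext fun x => ?_)
  have e : x = ![x 0, x 1] := by funext k; fin_cases k <;> rfl
  rw [e]
  exact h _ _

/-- The probability that the edge `d_i t` gives to the outcome `c`. -/
noncomputable def faceProb (t : (distSpace (nerveZMod 2)) _⦋2⦌) (i : Fin 3) (c : ZMod 2) : ℝ≥0 :=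
  StdSimplex.weights (M := Fin 1 → ZMod 2) ((distSpace (nerveZMod 2)).δ i t) ![c]

theorem faceProb_eq_sum (t : (distSpace (nerveZMod 2)) _⦋2⦌) (i : Fin 3) (c : ZMod 2) :
    faceProb t i c = ∑ x : Fin 2 → ZMod 2,
      if (show Fin 1 → ZMod 2 from (nerveZMod 2).δ (n := 1) i x) = ![c] then
        prob t (x 0) (x 1) else 0 := by
  have h := StdSimplex.map_weights_apply (M := Fin 2 → ZMod 2) (N := Fin 1 → ZMod 2) t
    ((nerveZMod 2).δ (n := 1) i) ![c]
  refine Eq.trans h (Finset.sum_congr rfl fun x _ => ?_)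
  have e : x = ![x 0, x 1] := by funext k; fin_cases k <;> rfl
  conv_lhs => rw [e]
  conv_rhs => rw [e]
  rfl

theorem faceProb_zero (t : (distSpace (nerveZMod 2)) _⦋2⦌) (c : ZMod 2) :
    faceProb t 0 c = prob t 0 c + prob t 1 c := by
  rw [faceProb_eq_sum, sum_pair]
  simp only [(nerveZMod_δ_pair 2 _ _).1]
  obtain rfl | rfl := zmod_two_cases c <;> simp

theorem faceProb_one (t : (distSpace (nerveZMod 2)) _⦋2⦌) (c : ZMod 2) :
    faceProb t 1 c = prob t 0 c + prob t 1 (c + 1) := by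
  rw [faceProb_eq_sum, sum_pair]
  simp only [(nerveZMod_δ_pair 2 _ _).2.1]
  obtain rfl | rfl := zmod_two_cases c <;> simp [zmod_two_one_add_one]

theorem faceProb_two (t : (distSpace (nerveZMod 2)) _⦋2⦌) (c : ZMod 2) :
    faceProb t 2 c = prob t c 0 + prob t c 1 := by
  rw [faceProb_eq_sum, sum_pair]
  simp only [(nerveZMod_δ_pair 2 _ _).2.2]
  obtain rfl | rfl := zmod_two_cases c <;> simp

theorem δ_eq_iff_faceProb {t t' : (distSpace (nerveZMod 2)) _⦋2⦌} {i j : Fin 3} :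
    (distSpace (nerveZMod 2)).δ i t = (distSpace (nerveZMod 2)).δ j t' ↔
      ∀ c, faceProb t i c = faceProb t' j c := by
  refine ⟨fun h c => by rw [faceProb, faceProb, h], fun h => ?_⟩
  refine StdSimplex.ext (R := ℝ≥0) (M := Fin 1 → ZMod 2) (Finsupp.ext fun x => ?_)
  have e : x = ![x 0] := by funext k; fin_cases k; rfl
  rw [e]
  exact h _

/-! ### Joint distributions with prescribed marginals -/

theorem exists_forall_le_forall_ge {ι κ : Type*} [Fintype ι] [Nonempty ι] (l : ι → ℝ) (u : κ → ℝ)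
    (h : ∀ i j, l i ≤ u j) : ∃ x, (∀ i, l i ≤ x) ∧ ∀ j, x ≤ u j :=
  ⟨Finset.univ.sup' Finset.univ_nonempty l, fun i => Finset.le_sup' l (Finset.mem_univ i),
    fun _ => Finset.sup'_le _ _ fun i _ => h i _⟩

theorem forall_zmod_two {P : ZMod 2 → Prop} : (∀ a, P a) ↔ P 0 ∧ P 1 :=
  ⟨fun h => ⟨h 0, h 1⟩, fun h a => by obtain rfl | rfl := zmod_two_cases a <;> tauto⟩

/-- The inequalities that characterize the triples `(P(u = 1), P(v = 1), P(u + v = 1))` for two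
random bits `u`, `v`: the triangle inequalities and the bound `2` on the perimeter. They are
symmetric in the three numbers. -/
structure ParityTriangle (a b c : ℝ) : Prop where
  le_fst : a ≤ b + c
  le_snd : b ≤ a + c
  le_thd : c ≤ a + b
  le_two : a + b + c ≤ 2

theorem parityTriangle_of_nonneg {P : ZMod 2 → ZMod 2 → ℝ} (hP : ∀ a b, 0 ≤ P a b)
    (sP : P 0 0 + P 0 1 + (P 1 0 + P 1 1) = 1) :
    ParityTriangle (P 1 0 + P 1 1) (P 0 1 + P 1 1) (P 0 1 + P 1 0) := by
  have h00 := hP 0 0; have h01 := hP 0 1; have h10 := hP 1 0; have h11 := hP 1 1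
  constructor <;> linarith

theorem ParityTriangle.exists_pair {a b c : ℝ} (h : ParityTriangle a b c) :
    ∃ P : ZMod 2 → ZMod 2 → ℝ, (∀ x y, 0 ≤ P x y) ∧ P 0 0 + P 0 1 + (P 1 0 + P 1 1) = 1 ∧
      P 1 0 + P 1 1 = a ∧ P 0 1 + P 1 1 = b ∧ P 0 1 + P 1 0 = c := by
  obtain ⟨h1, h2, h3, h4⟩ := h
  refine ⟨fun x y => if x = 0 then (if y = 0 then (2 - a - b - c) / 2 else (b + c - a) / 2)
    else (if y = 0 then (a + c - b) / 2 else (a + b - c) / 2), ?_, ?_, ?_, ?_, ?_⟩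
  · simp only [forall_zmod_two, one_ne_zero, if_true, if_false]
    refine ⟨⟨?_, ?_⟩, ?_, ?_⟩ <;> linarith
  all_goals simp only [one_ne_zero, if_true, if_false]; ring

/-- The inequalities of Clauser, Horne, Shimony and Holt in geometric form. The numbers
`a, b, c, d` are `P(y + x = 1)`, `P(y + x' = 1)`, `P(x + y' = 1)` and `P(x' + y' = 1)`. If the
triangles `(a, d, v)` and `(b, c, v)` have a common third side, then so do the triangles `(a, b, w)`
and `(c, d, w)`, with a `w` that is moreover a possible value of `P(x + x' = 1)`. -/
theorem ParityTriangle.exists_diagonal {a b c d v x x' y y' : ℝ}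
    (had : ParityTriangle a d v) (hbc : ParityTriangle b c v)
    (ha : ParityTriangle y x a) (hb : ParityTriangle y x' b)
    (hc : ParityTriangle x y' c) (hd : ParityTriangle x' y' d) :
    ∃ w, ParityTriangle a b w ∧ ParityTriangle c d w ∧ ParityTriangle x x' w := by
  obtain ⟨w, hl, hu⟩ := exists_forall_le_forall_ge
    ![a - b, b - a, c - d, d - c, x - x', x' - x]
    ![a + b, 2 - a - b, c + d, 2 - c - d, x + x', 2 - x - x'] (by
      obtain ⟨_, _, _, _⟩ := had
      obtain ⟨_, _, _, _⟩ := hbc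
      obtain ⟨_, _, _, _⟩ := ha
      obtain ⟨_, _, _, _⟩ := hb
      obtain ⟨_, _, _, _⟩ := hc
      obtain ⟨_, _, _, _⟩ := hd
      simp only [Fin.forall_fin_succ, Fin.isValue, Matrix.cons_val_zero, Matrix.cons_val_succ,
        IsEmpty.forall_iff, and_true]
      refine ⟨?_, ?_, ?_, ?_, ?_, ?_⟩ <;> refine ⟨?_, ?_, ?_, ?_, ?_, ?_⟩ <;> linarith)
  simp only [Fin.forall_fin_succ, Fin.isValue, Matrix.cons_val_zero, Matrix.cons_val_succ,
    IsEmpty.forall_iff, and_true] at hl hu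
  obtain ⟨l1, l2, l3, l4, l5, l6⟩ := hl
  obtain ⟨u1, u2, u3, u4, u5, u6⟩ := hu
  refine ⟨w, ?_, ?_, ?_⟩ <;> constructor <;> linarith

/-- Pair distributions `A` of `(y, x)`, `B` of `(y, x')` and `M` of `(x, x')` with matching
one-bit marginals come from a joint distribution of the three bits if and only if the
disagreement probabilities form a `ParityTriangle`; this is the existence half. -/
theorem exists_triple {A B M : ZMod 2 → ZMod 2 → ℝ}
    (hA : ∀ a b, 0 ≤ A a b) (hB : ∀ a b, 0 ≤ B a b) (hM : ∀ a b, 0 ≤ M a b)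
    (hy : ∀ y, A y 0 + A y 1 = B y 0 + B y 1)
    (hx : ∀ x, A 0 x + A 1 x = M x 0 + M x 1)
    (hx' : ∀ x, B 0 x + B 1 x = M 0 x + M 1 x)
    (sM : M 0 0 + M 0 1 + (M 1 0 + M 1 1) = 1)
    (h : ParityTriangle (A 0 1 + A 1 0) (B 0 1 + B 1 0) (M 0 1 + M 1 0)) :
    ∃ E : ZMod 2 → ZMod 2 → ZMod 2 → ℝ, (∀ y x x', 0 ≤ E y x x') ∧
      (∀ y x, A y x = E y x 0 + E y x 1) ∧ (∀ y x', B y x' = E y 0 x' + E y 1 x') ∧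
      ∀ x x', M x x' = E 0 x x' + E 1 x x' := by
  obtain ⟨h1, h2, h3, h4⟩ := h
  simp only [forall_zmod_two] at *
  obtain ⟨⟨_, _⟩, _, _⟩ := hA
  obtain ⟨⟨_, _⟩, _, _⟩ := hB
  obtain ⟨⟨_, _⟩, _, _⟩ := hM
  obtain ⟨_, _⟩ := hy
  obtain ⟨_, _⟩ := hx
  obtain ⟨_, _⟩ := hx'
  -- The marginals leave one parameter free, the probability `e` of `(0, 0, 0)`; the bounds are the
  -- nonnegativity of the eight probabilities.
  obtain ⟨e, hl, hu⟩ := exists_forall_le_forall_ge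
    ![0, B 0 0 - A 0 1, M 0 0 - A 1 0, M 0 0 - B 1 0]
    ![A 0 0, B 0 0, M 0 0, A 1 1 - B 1 0 + M 0 0] (by
      simp only [Fin.forall_fin_succ, Fin.isValue, Matrix.cons_val_zero, Matrix.cons_val_succ,
        IsEmpty.forall_iff, and_true]
      refine ⟨?_, ?_, ?_, ?_⟩ <;> refine ⟨?_, ?_, ?_, ?_⟩ <;> linarith)
  simp only [Fin.forall_fin_succ, Fin.isValue, Matrix.cons_val_zero, Matrix.cons_val_succ,
    IsEmpty.forall_iff, and_true] at hl hu
  obtain ⟨l1, l2, l3, l4⟩ := hl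
  obtain ⟨u1, u2, u3, u4⟩ := hu
  refine ⟨fun y x x' =>
    if y = 0 then
      if x = 0 then (if x' = 0 then e else A 0 0 - e)
      else (if x' = 0 then B 0 0 - e else A 0 1 - B 0 0 + e)
    else
      if x = 0 then (if x' = 0 then M 0 0 - e else A 1 0 - M 0 0 + e)
      else (if x' = 0 then B 1 0 - M 0 0 + e else A 1 1 - B 1 0 + M 0 0 - e), ?_, ?_, ?_, ?_⟩
  all_goals simp only [one_ne_zero, if_true, if_false]
  · refine ⟨⟨⟨?_, ?_⟩, ?_, ?_⟩, ⟨?_, ?_⟩, ?_, ?_⟩ <;> linarith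
  all_goals refine ⟨⟨?_, ?_⟩, ?_, ?_⟩ <;> linarith

/-- Summing out one side of the conditionally independent gluing `e * f / M` returns `e`. Where the
common marginal `M` vanishes, the quotient is `0`, and so is `e`. -/
theorem glue_marginal {M e f₀ f₁ : ℝ} (he : 0 ≤ e) (heM : e ≤ M) (hf : M = f₀ + f₁) :
    e * f₀ / M + e * f₁ / M = e := by
  rcases eq_or_ne M 0 with h | h
  · rw [h, div_zero, div_zero]; linarith
  · rw [← add_div, ← mul_add, ← hf, mul_div_cancel_right₀ _ h]

/-- Fine's theorem: distributions `A`, `B`, `C`, `D` of `(y₀, x₀)`, `(y₀, x₁)`, `(x₀, y₁)` and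
`(x₁, y₁)` with matching one-bit marginals come from a joint distribution of the four bits, provided
that the parity probabilities of `A`, `D` and of `B`, `C` span triangles with a common third side.
-/
theorem exists_joint_of_parityTriangle {A B C D : ZMod 2 → ZMod 2 → ℝ}
    (hA : ∀ a b, 0 ≤ A a b) (hB : ∀ a b, 0 ≤ B a b)
    (hC : ∀ a b, 0 ≤ C a b) (hD : ∀ a b, 0 ≤ D a b)
    (sA : A 0 0 + A 0 1 + (A 1 0 + A 1 1) = 1) (sB : B 0 0 + B 0 1 + (B 1 0 + B 1 1) = 1)
    (sC : C 0 0 + C 0 1 + (C 1 0 + C 1 1) = 1) (sD : D 0 0 + D 0 1 + (D 1 0 + D 1 1) = 1)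
    (hy₀ : ∀ y, A y 0 + A y 1 = B y 0 + B y 1) (hx₀ : ∀ x, A 0 x + A 1 x = C x 0 + C x 1)
    (hx₁ : ∀ x, B 0 x + B 1 x = D x 0 + D x 1) (hy₁ : ∀ y, C 0 y + C 1 y = D 0 y + D 1 y)
    {v : ℝ} (hAD : ParityTriangle (A 0 1 + A 1 0) (D 0 1 + D 1 0) v)
    (hBC : ParityTriangle (B 0 1 + B 1 0) (C 0 1 + C 1 0) v) :
    ∃ H : ZMod 2 → ZMod 2 → ZMod 2 → ZMod 2 → ℝ, (∀ y₀ x₀ x₁ y₁, 0 ≤ H y₀ x₀ x₁ y₁) ∧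
      (∀ y x, A y x = H y x 0 0 + H y x 0 1 + (H y x 1 0 + H y x 1 1)) ∧
      (∀ y x, B y x = H y 0 x 0 + H y 0 x 1 + (H y 1 x 0 + H y 1 x 1)) ∧
      (∀ x y, C x y = H 0 x 0 y + H 0 x 1 y + (H 1 x 0 y + H 1 x 1 y)) ∧
      ∀ x y, D x y = H 0 0 x y + H 0 1 x y + (H 1 0 x y + H 1 1 x y) := by
  have tA := parityTriangle_of_nonneg hA sA
  have tB := parityTriangle_of_nonneg hB sB
  have tC := parityTriangle_of_nonneg hC sC
  have tD := parityTriangle_of_nonneg hD sD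
  rw [add_comm (A 0 1) (A 1 1), add_comm (A 1 1), hx₀] at tA
  rw [← hy₀, add_comm (B 0 1) (B 1 1), add_comm (B 1 1), hx₁] at tB
  rw [← hy₁] at tD
  obtain ⟨w, hab, hcd, hxx⟩ := hAD.exists_diagonal hBC tA tB tC tD
  -- `M` is the distribution of `(x₀, x₁)`; it is extended to `E` by `y₀` and to `F` by `y₁`.
  obtain ⟨M, hM, sM, m1, m2, m3⟩ := hxx.exists_pair
  have hx₀' : ∀ x, C x 0 + C x 1 = M x 0 + M x 1 := by
    rw [forall_zmod_two]; constructor <;> linarith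
  have hx₁' : ∀ x, D x 0 + D x 1 = M 0 x + M 1 x := by
    rw [forall_zmod_two]; constructor <;> linarith
  obtain ⟨E, hE, eA, eB, eM⟩ := exists_triple hA hB hM hy₀ (fun x => (hx₀ x).trans (hx₀' x))
    (fun x => (hx₁ x).trans (hx₁' x)) sM (m3 ▸ hab)
  obtain ⟨F, hF, fC, fD, fM⟩ := exists_triple (A := fun y x => C x y) (B := fun y x => D x y)
    (fun _ _ => hC _ _) (fun _ _ => hD _ _) hM hy₁ hx₀' hx₁' sM (by
      simpa only [m3, add_comm] using hcd)
  have hEM (y x x') : E y x x' ≤ M x x' := by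
    have h0 := hE 0 x x'; have h1 := hE 1 x x'; have := eM x x'
    obtain rfl | rfl := zmod_two_cases y <;> linarith
  have hFM (y x x') : F y x x' ≤ M x x' := by
    have h0 := hF 0 x x'; have h1 := hF 1 x x'; have := fM x x'
    obtain rfl | rfl := zmod_two_cases y <;> linarith
  have gE (y x x') := glue_marginal (hE y x x') (hEM y x x') (fM x x')
  have gF (y x x') : E 0 x x' * F y x x' / M x x' + E 1 x x' * F y x x' / M x x' = F y x x' := by
    simpa only [mul_comm] using glue_marginal (hF y x x') (hFM y x x') (eM x x')
  -- Make `y₀` and `y₁` independent conditionally on `(x₀, x₁)`.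
  refine ⟨fun y₀ x₀ x₁ y₁ => E y₀ x₀ x₁ * F y₁ x₀ x₁ / M x₀ x₁,
    fun _ _ _ _ => div_nonneg (mul_nonneg (hE _ _ _) (hF _ _ _)) (hM _ _),
    fun y x => ?_, fun y x => ?_, fun x y => ?_, fun x y => ?_⟩
  · rw [gE, gE, eA]
  · rw [gE, gE, eB]
  · rw [add_add_add_comm, gF, gF, fC]
  · rw [add_add_add_comm, gF, gF, fD]

/-! ### Classical distributions and maps of measurement spaces -/

theorem comp_classicalToSimplicial {X X' Y : SSet.{0}} (f : X ⟶ X')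
    (d : StdSimplex ℝ≥0 (X' ⟶ Y)) :
    f ≫ classicalToSimplicial d = classicalToSimplicial (d.map (f ≫ ·)) := by
  ext n s : 4
  exact (StdSimplex.map_map d (f ≫ ·) fun r => r.app n s).symm

theorem Noncontextual.comp {X X' Y : SSet.{0}} (f : X ⟶ X') {p : SimplicialDist X' Y}
    (h : Noncontextual p) : Noncontextual (f ≫ p) := by
  obtain ⟨d, rfl⟩ := h
  exact ⟨_, (comp_classicalToSimplicial f d).symm⟩

theorem Noncontextual.extendsAlong {X X' Y : SSet.{0}} {f : X ⟶ X'} {p : SimplicialDist X Y}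
    (h : Noncontextual p) (ext : ∀ r : X ⟶ Y, ∃ r' : X' ⟶ Y, f ≫ r' = r) : ExtendsAlong f p := by
  obtain ⟨d, rfl⟩ := h
  choose e he using ext
  refine ⟨classicalToSimplicial (d.map e), ?_⟩
  rw [comp_classicalToSimplicial, StdSimplex.map_map]
  simp only [he]
  exact congrArg classicalToSimplicial (StdSimplex.map_id d)

theorem noncontextual_of_comp_toRange {X X' Y : SSet.{0}} {f : X ⟶ X'}
    {p : SimplicialDist (SSet.Subcomplex.range f : SSet.{0}) Y}
    (h : Noncontextual (SSet.Subcomplex.toRange f ≫ p))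
    (ext : ∀ r : X ⟶ Y, ∃ r' : X' ⟶ Y, f ≫ r' = r) : Noncontextual p := by
  obtain ⟨q, hq⟩ := h
  choose e he using ext
  refine ⟨q.map fun r => (SSet.Subcomplex.range f).ι ≫ e r, ?_⟩
  rw [← cancel_epi (SSet.Subcomplex.toRange f), ← hq, comp_classicalToSimplicial,
    StdSimplex.map_map]
  refine Eq.trans (congrArg classicalToSimplicial (congrArg (StdSimplex.map · q) ?_))
    (congrArg classicalToSimplicial (StdSimplex.map_id q))
  funext r
  exact he r

/-! ### Outcome maps -/

theorem nerveZMod_δ_eq_iff {d : ℕ} {i j : Fin 3} {s t : Fin 2 → ZMod d} :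
    (nerveZMod d).δ (n := 1) i s = (nerveZMod d).δ (n := 1) j t ↔
      ![s 1, s 0 + s 1, s 0] i = ![t 1, t 0 + t 1, t 0] j := by
  have key (i : Fin 3) (s : Fin 2 → ZMod d) :
      (nerveZMod d).δ (n := 1) i s = ![![s 1, s 0 + s 1, s 0] i] := by
    obtain ⟨h0, h1, h2⟩ := nerveZMod_δ_pair d (s 0) (s 1)
    have e : s = ![s 0, s 1] := by funext k; fin_cases k <;> rfl
    rw [← e] at h0 h1 h2
    fin_cases i
    exacts [h0, h1, h2]
  rw [key, key]
  exact ⟨fun h => congrFun h 0, fun h => by rw [h]⟩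

/-- The outcomes `(d_2, d_0)` on the triangles of the torus, given outcomes of the four
measurements; on the two triangles of the diamond they are forced by the outcomes of the edges
`x_i ⊕ y_j`. -/
def torusOutcomePair (y₀ x₀ x₁ y₁ : ZMod 2) : TorusContext → Fin 2 → ZMod 2 :=
  fun g => match g with
  | chsh y0x0 => ![y₀, x₀]
  | chsh y0x1 => ![y₀, x₁]
  | chsh x0y1 => ![x₀, y₁]
  | chsh x1y1 => ![x₁, y₁]
  | plus => ![y₀ + x₀, x₁ + y₁]
  | minus => ![y₀ + x₁, x₀ + y₁]

theorem δ_torusOutcomePair_eq (y₀ x₀ x₁ y₁ : ZMod 2) (ρ : EdgeRelation TorusContext)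
    (hρ : ρ ∈ torusRelations) :
    (nerveZMod 2).δ (n := 1) ρ.i (torusOutcomePair y₀ x₀ x₁ y₁ ρ.left) =
      (nerveZMod 2).δ (n := 1) ρ.j (torusOutcomePair y₀ x₀ x₁ y₁ ρ.right) := by
  refine nerveZMod_δ_eq_iff.2 ?_
  obtain rfl | rfl | rfl | rfl | rfl | rfl | rfl | rfl | rfl := hρ <;>
    -- Only the common edge of the diamond needs an argument: `(y₀ + x₀) + (x₁ + y₁)` is
    -- `(y₀ + x₁) + (x₀ + y₁)`.
    first | rfl | exact add_add_add_comm _ _ _ _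

/-- The outcome map on the torus with the given outcomes of the four measurements. -/
def torusOutcome (y₀ x₀ x₁ y₁ : ZMod 2) : torus ⟶ nerveZMod 2 :=
  glueTrianglesDesc (torusOutcomePair y₀ x₀ x₁ y₁) (δ_torusOutcomePair_eq y₀ x₀ x₁ y₁)

/-- The outcomes `(d_2, d_0)` that `r` assigns to a triangle. -/
def outcomePair {X : SSet.{0}} (r : X ⟶ nerveZMod 2) (σ : X _⦋2⦌) : Fin 2 → ZMod 2 :=
  r.app (op ⦋2⦌) σ

theorem outcomePair_torusOutcome (y₀ x₀ x₁ y₁ : ZMod 2) (c : CHSHContext) :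
    outcomePair (chshToTorus ≫ torusOutcome y₀ x₀ x₁ y₁) (chshTriangle c) =
      torusOutcomePair y₀ x₀ x₁ y₁ (chsh c) :=
  glueTrianglesDesc_triangle (Y := nerveZMod 2) (torusOutcomePair y₀ x₀ x₁ y₁)
    (δ_torusOutcomePair_eq y₀ x₀ x₁ y₁) (chsh c)

theorem outcomePair_chsh_relations (r : chshSpace ⟶ nerveZMod 2) :
    outcomePair r (chshTriangle y0x0) 1 = outcomePair r (chshTriangle x0y1) 0 ∧
    outcomePair r (chshTriangle y0x1) 1 = outcomePair r (chshTriangle x1y1) 0 ∧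
    outcomePair r (chshTriangle y0x0) 0 = outcomePair r (chshTriangle y0x1) 0 ∧
    outcomePair r (chshTriangle x0y1) 1 = outcomePair r (chshTriangle x1y1) 1 := by
  have h (ρ) (hρ : ρ ∈ chshRelations) := nerveZMod_δ_eq_iff.1 (δ_app_triangle r hρ)
  exact ⟨h ⟨y0x0, 0, x0y1, 2⟩ (by simp [chshRelations]),
    h ⟨y0x1, 0, x1y1, 2⟩ (by simp [chshRelations]),
    h ⟨y0x0, 2, y0x1, 2⟩ (by simp [chshRelations]),
    h ⟨x0y1, 0, x1y1, 0⟩ (by simp [chshRelations])⟩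

/-- Deterministic outcomes never obstruct the extension: the nerve has a single vertex, so that
the collapse of vertices in `chshToTorus` is harmless, and the diamond can always be filled. -/
theorem exists_chshToTorus_comp_eq (r : chshSpace ⟶ nerveZMod 2) :
    ∃ r' : torus ⟶ nerveZMod 2, chshToTorus ≫ r' = r := by
  obtain ⟨h1, h2, h3, h4⟩ := outcomePair_chsh_relations r
  refine ⟨torusOutcome (outcomePair r (chshTriangle y0x0) 0) (outcomePair r (chshTriangle y0x0) 1)
    (outcomePair r (chshTriangle y0x1) 1) (outcomePair r (chshTriangle x0y1) 1),
    glueTriangles_hom_ext fun c => ?_⟩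
  have e (c : CHSHContext) : r.app (op ⦋2⦌) (chshTriangle c) =
      (show Fin 2 → ZMod 2 from ![outcomePair r (chshTriangle c) 0,
        outcomePair r (chshTriangle c) 1]) := by
    funext k; fin_cases k <;> rfl
  cases c
  · exact (outcomePair_torusOutcome _ _ _ _ _).trans (e _).symm
  · refine (outcomePair_torusOutcome _ _ _ _ _).trans (Eq.trans ?_ (e _).symm)
    simp only [torusOutcomePair, h3]
  · refine (outcomePair_torusOutcome _ _ _ _ _).trans (Eq.trans ?_ (e _).symm)
    simp only [torusOutcomePair, h1]
  · refine (outcomePair_torusOutcome _ _ _ _ _).trans (Eq.trans ?_ (e _).symm)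
    simp only [torusOutcomePair, h2, h4]

/-! ### Extension to the torus and noncontextuality -/

theorem prob_classicalToSimplicial {X : SSet.{0}} {Λ : Type} [Fintype Λ]
    (d : StdSimplex ℝ≥0 Λ) (r : Λ → (X ⟶ nerveZMod 2)) (σ : X _⦋2⦌) (a b : ZMod 2) :
    prob ((classicalToSimplicial (d.map r)).app (op ⦋2⦌) σ) a b =
      ∑ l, if outcomePair (r l) σ = ![a, b] then d.weights l else 0 := by
  refine Eq.trans ?_ (StdSimplex.map_weights_apply d (fun l => outcomePair (r l) σ) ![a, b])
  exact congrArg (fun t : StdSimplex ℝ≥0 (Fin 2 → ZMod 2) => t.weights ![a, b])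
    (StdSimplex.map_map d r fun r => outcomePair r σ)

theorem noncontextual_of_joint {p : SimplicialDist chshSpace (nerveZMod 2)}
    (H : ZMod 2 → ZMod 2 → ZMod 2 → ZMod 2 → ℝ≥0)
    (hA : ∀ y x, prob (p.app (op ⦋2⦌) (chshTriangle y0x0)) y x =
      H y x 0 0 + H y x 0 1 + (H y x 1 0 + H y x 1 1))
    (hB : ∀ y x, prob (p.app (op ⦋2⦌) (chshTriangle y0x1)) y x =
      H y 0 x 0 + H y 0 x 1 + (H y 1 x 0 + H y 1 x 1))
    (hC : ∀ x y, prob (p.app (op ⦋2⦌) (chshTriangle x0y1)) x y =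
      H 0 x 0 y + H 0 x 1 y + (H 1 x 0 y + H 1 x 1 y))
    (hD : ∀ x y, prob (p.app (op ⦋2⦌) (chshTriangle x1y1)) x y =
      H 0 0 x y + H 0 1 x y + (H 1 0 x y + H 1 1 x y)) :
    Noncontextual p := by
  have univ_zmod (F : ZMod 2 → ℝ≥0) : ∑ a, F a = F 0 + F 1 := Fin.sum_univ_two F
  let d : StdSimplex ℝ≥0 (ZMod 2 × ZMod 2 × ZMod 2 × ZMod 2) :=
    { weights := Finsupp.equivFunOnFinite.symm fun l => H l.1 l.2.1 l.2.2.1 l.2.2.2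
      nonneg := fun _ => zero_le
      total := by
        rw [Finsupp.sum_fintype _ _ (by simp), ← sum_prob (p.app (op ⦋2⦌) (chshTriangle y0x0))]
        simp only [hA, Finsupp.equivFunOnFinite_symm_apply_apply, Fintype.sum_prod_type,
          univ_zmod] }
  refine ⟨d.map fun l => chshToTorus ≫ torusOutcome l.1 l.2.1 l.2.2.1 l.2.2.2,
    glueTriangles_hom_ext fun c => dist_two_ext fun a b => ?_⟩
  refine (prob_classicalToSimplicial d _ (chshTriangle c) a b).trans ?_
  have hd (l) : d.weights l = H l.1 l.2.1 l.2.2.1 l.2.2.2 := rfl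
  have pair (a b a' b' : ZMod 2) : ![a, b] = ![a', b'] ↔ a = a' ∧ b = b' := by simp
  cases c
  · refine Eq.trans ?_ (hA a b).symm
    simp only [outcomePair_torusOutcome, torusOutcomePair, pair, hd, Fintype.sum_prod_type,
      univ_zmod]
    obtain rfl | rfl := zmod_two_cases a <;> obtain rfl | rfl := zmod_two_cases b <;> simp
  · refine Eq.trans ?_ (hB a b).symm
    simp only [outcomePair_torusOutcome, torusOutcomePair, pair, hd, Fintype.sum_prod_type,
      univ_zmod]
    obtain rfl | rfl := zmod_two_cases a <;> obtain rfl | rfl := zmod_two_cases b <;> simp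
  · refine Eq.trans ?_ (hC a b).symm
    simp only [outcomePair_torusOutcome, torusOutcomePair, pair, hd, Fintype.sum_prod_type,
      univ_zmod]
    obtain rfl | rfl := zmod_two_cases a <;> obtain rfl | rfl := zmod_two_cases b <;> simp
  · refine Eq.trans ?_ (hD a b).symm
    simp only [outcomePair_torusOutcome, torusOutcomePair, pair, hd, Fintype.sum_prod_type,
      univ_zmod]
    obtain rfl | rfl := zmod_two_cases a <;> obtain rfl | rfl := zmod_two_cases b <;> simp

/-- On the torus, the triangles `σ_±` exhibit `P(c = 1)`, for `c` their common edge, as the third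
side that Fine's theorem asks for. -/
theorem noncontextual_chshToTorus_comp (q : SimplicialDist torus (nerveZMod 2)) :
    Noncontextual (chshToTorus ≫ q) := by
  set t : TorusContext → (distSpace (nerveZMod 2)) _⦋2⦌ :=
    fun g => q.app (op ⦋2⦌) (triangle torusRelations g) with ht
  have face (ρ : EdgeRelation TorusContext) (hρ : ρ ∈ torusRelations) (c : ZMod 2) :
      (faceProb (t ρ.left) ρ.i c : ℝ) = faceProb (t ρ.right) ρ.j c :=
    congrArg _ (δ_eq_iff_faceProb.1 (δ_app_triangle q hρ) c)
  have nn (g : TorusContext) (a b : ZMod 2) : (0 : ℝ) ≤ prob (t g) a b := NNReal.coe_nonneg _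
  have tot (g : TorusContext) : (prob (t g) 0 0 + prob (t g) 0 1 +
      (prob (t g) 1 0 + prob (t g) 1 1) : ℝ) = 1 := by exact_mod_cast sum_prob (t g)
  have hx₀ := face ⟨chsh y0x0, 0, chsh x0y1, 2⟩ (by simp [torusRelations])
  have hx₁ := face ⟨chsh y0x1, 0, chsh x1y1, 2⟩ (by simp [torusRelations])
  have hy₀ := face ⟨chsh y0x0, 2, chsh y0x1, 2⟩ (by simp [torusRelations])
  have hy₁ := face ⟨chsh x0y1, 0, chsh x1y1, 0⟩ (by simp [torusRelations])
  have hA := face ⟨plus, 2, chsh y0x0, 1⟩ (by simp [torusRelations]) 1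
  have hD := face ⟨plus, 0, chsh x1y1, 1⟩ (by simp [torusRelations]) 1
  have hB := face ⟨minus, 2, chsh y0x1, 1⟩ (by simp [torusRelations]) 1
  have hC := face ⟨minus, 0, chsh x0y1, 1⟩ (by simp [torusRelations]) 1
  have hv := face ⟨plus, 1, minus, 1⟩ (by simp [torusRelations]) 1
  simp only [faceProb_zero, faceProb_one, faceProb_two, zmod_two_one_add_one, NNReal.coe_add]
    at hx₀ hx₁ hy₀ hy₁ hA hB hC hD hv
  have tp := parityTriangle_of_nonneg (nn plus) (tot plus)
  have tm := parityTriangle_of_nonneg (nn minus) (tot minus)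
  rw [hA, hD] at tp
  rw [hB, hC, ← hv] at tm
  obtain ⟨H, hH, eA, eB, eC, eD⟩ := exists_joint_of_parityTriangle (nn _) (nn _) (nn _) (nn _)
    (tot _) (tot _) (tot _) (tot _) hy₀ hx₀ hx₁ hy₁ tp tm
  lift H to ZMod 2 → ZMod 2 → ZMod 2 → ZMod 2 → ℝ≥0 using hH
  exact noncontextual_of_joint H (fun _ _ => NNReal.eq (eA _ _)) (fun _ _ => NNReal.eq (eB _ _))
    (fun _ _ => NNReal.eq (eC _ _)) (fun _ _ => NNReal.eq (eD _ _))

theorem extendsAlong_chshToTorus_iff (p : SimplicialDist chshSpace (nerveZMod 2)) :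
    ExtendsAlong chshToTorus p ↔ Noncontextual p := by
  refine ⟨?_, fun h => h.extendsAlong exists_chshToTorus_comp_eq⟩
  rintro ⟨q, rfl⟩
  exact noncontextual_chshToTorus_comp q

theorem extendsAlong_puncturedTorus_iff (p : SimplicialDist puncturedTorus (nerveZMod 2)) :
    ExtendsAlong puncturedTorus.ι p ↔ Noncontextual p := by
  refine ⟨?_, fun h => h.extendsAlong fun r => ?_⟩
  · rintro ⟨q, rfl⟩
    exact noncontextual_of_comp_toRange (noncontextual_chshToTorus_comp q)
      exists_chshToTorus_comp_eq
  · obtain ⟨r', hr'⟩ := exists_chshToTorus_comp_eq (SSet.Subcomplex.toRange chshToTorus ≫ r)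
    exact ⟨r', (cancel_epi (SSet.Subcomplex.toRange chshToTorus)).1 hr'⟩

/-! ### The Popescu–Rohrlich box -/

/-- The sum of the two outcomes in each context of the Popescu–Rohrlich box. -/
def prParity (c : CHSHContext) : ZMod 2 :=
  match c with
  | y0x0 => 1
  | _ => 0

theorem isPRBox_iff {X : SSet.{0}} {tri : CHSHContext → X _⦋2⦌}
    {p : SimplicialDist X (nerveZMod 2)} :
    IsPRBox tri p ↔ ∀ c a b,
      prob (p.app (op ⦋2⦌) (tri c)) a b = if a + b = prParity c then 1 / 2 else 0 :=
  ⟨fun ⟨h1, h2, h3, h4⟩ c => by cases c <;> assumption,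
    fun h => ⟨h y0x0, h y0x1, h x0y1, h x1y1⟩⟩

theorem nnreal_half_add_half : (2⁻¹ : ℝ≥0) + 2⁻¹ = 1 := by
  rw [← two_mul, mul_inv_cancel₀ two_ne_zero]

/-- The uniform distribution on the pairs `(a, b)` with `a + b = s`. -/
noncomputable def parityDist (s : ZMod 2) : (distSpace (nerveZMod 2)) _⦋2⦌ :=
  show StdSimplex ℝ≥0 (Fin 2 → ZMod 2) from
  { weights := Finsupp.equivFunOnFinite.symm fun x => if x 0 + x 1 = s then 1 / 2 else 0
    nonneg := fun _ => zero_le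
    total := by
      rw [Finsupp.sum_fintype _ _ (by simp), sum_pair]
      obtain rfl | rfl := zmod_two_cases s <;>
        simp [zmod_two_one_add_one, nnreal_half_add_half] }

theorem prob_parityDist (s a b : ZMod 2) :
    prob (parityDist s) a b = if a + b = s then 1 / 2 else 0 := rfl

theorem faceProb_parityDist_zero (s c : ZMod 2) : faceProb (parityDist s) 0 c = 1 / 2 := by
  rw [faceProb_zero, prob_parityDist, prob_parityDist]
  obtain rfl | rfl := zmod_two_cases s <;> obtain rfl | rfl := zmod_two_cases c <;>
    simp [zmod_two_one_add_one]

theorem faceProb_parityDist_two (s c : ZMod 2) : faceProb (parityDist s) 2 c = 1 / 2 := by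
  rw [faceProb_two, prob_parityDist, prob_parityDist]
  obtain rfl | rfl := zmod_two_cases s <;> obtain rfl | rfl := zmod_two_cases c <;>
    simp [zmod_two_one_add_one]

theorem δ_one_parityDist (s : ZMod 2) :
    (distSpace (nerveZMod 2)).δ 1 (parityDist s) =
      (show StdSimplex ℝ≥0 (Fin 1 → ZMod 2) from StdSimplex.single ![s]) := by
  refine StdSimplex.ext (R := ℝ≥0) (M := Fin 1 → ZMod 2) (Finsupp.ext fun x => ?_)
  have e : x = ![x 0] := by funext k; fin_cases k; rfl
  rw [e]
  change faceProb (parityDist s) 1 (x 0) = (StdSimplex.single (R := ℝ≥0) ![s]).weights ![x 0]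
  rw [faceProb_one, prob_parityDist, prob_parityDist, StdSimplex.weights_single,
    Finsupp.single_apply]
  obtain rfl | rfl := zmod_two_cases s <;> obtain h | h := zmod_two_cases (x 0) <;>
    simp [h, zmod_two_one_add_one, nnreal_half_add_half]

/-- The `d_1`-edge of `parityDist s` is deterministic with outcome `s`; along a degenerate simplex
of this edge, the outcome is `s` on the one step that crosses the edge. -/
theorem map_δ_one_parityDist {n : SimplexCategoryᵒᵖ} (u : n.unop ⟶ ⦋1⦌) (s : ZMod 2) :
    (distSpace (nerveZMod 2)).map u.op ((distSpace (nerveZMod 2)).δ 1 (parityDist s)) =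
      (show StdSimplex ℝ≥0 (Fin n.unop.len → ZMod 2) from StdSimplex.single fun k =>
        if u.toOrderHom k.castSucc = u.toOrderHom k.succ then 0 else s) := by
  rw [δ_one_parityDist]
  refine (StdSimplex.map_single (R := ℝ≥0) (![s] : Fin 1 → ZMod 2)
    ((nerveZMod 2).map u.op)).trans (congrArg _ (funext fun k => ?_))
  change Fin.partialSum ![s] (u.toOrderHom k.succ) - Fin.partialSum ![s] (u.toOrderHom k.castSucc)
    = _
  generalize u.toOrderHom k.succ = i
  generalize u.toOrderHom k.castSucc = j
  have key : ∀ s : ZMod 2, ∀ i j : Fin 2,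
    Fin.partialSum ![s] i - Fin.partialSum ![s] j = if j = i then 0 else s := by decide
  exact key s i j

theorem δ_parityDist_eq (ρ : EdgeRelation CHSHContext) (hρ : ρ ∈ chshRelations) :
    (distSpace (nerveZMod 2)).δ ρ.i (parityDist (prParity ρ.left)) =
      (distSpace (nerveZMod 2)).δ ρ.j (parityDist (prParity ρ.right)) := by
  refine δ_eq_iff_faceProb.2 fun c => ?_
  obtain rfl | rfl | rfl | rfl := hρ <;>
    simp only [faceProb_parityDist_zero, faceProb_parityDist_two]

/-- The Popescu–Rohrlich box on the CHSH measurement space. -/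
noncomputable def prBox : SimplicialDist chshSpace (nerveZMod 2) :=
  glueTrianglesDesc (fun c => parityDist (prParity c)) δ_parityDist_eq

theorem isPRBox_prBox : IsPRBox chshTriangle prBox := by
  rw [isPRBox_iff]
  intro c a b
  have h : prBox.app (op ⦋2⦌) (chshTriangle c) = parityDist (prParity c) :=
    glueTrianglesDesc_triangle _ _ _
  rw [h, prob_parityDist]

theorem IsPRBox.unique {p p' : SimplicialDist chshSpace (nerveZMod 2)}
    (h : IsPRBox chshTriangle p) (h' : IsPRBox chshTriangle p') : p = p' := by
  rw [isPRBox_iff] at h h'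
  exact glueTriangles_hom_ext fun c => dist_two_ext fun a b => (h c a b).trans (h' c a b).symm

/-- An outcome map in the support has the four prescribed parities; they add up to `1`, whereas
each measurement occurs in two contexts and contributes `0` to the sum. -/
theorem IsPRBox.contextual {p : SimplicialDist chshSpace (nerveZMod 2)}
    (h : IsPRBox chshTriangle p) : Contextual p := by
  rintro ⟨d, rfl⟩
  rw [isPRBox_iff] at h
  obtain ⟨r, hr⟩ := d.support_weights_nonempty
  have parity (c : CHSHContext) :
      outcomePair r (chshTriangle c) 0 + outcomePair r (chshTriangle c) 1 = prParity c := by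
    by_contra hne
    have h0 := h c (outcomePair r (chshTriangle c) 0) (outcomePair r (chshTriangle c) 1)
    rw [if_neg hne] at h0
    have e : ![outcomePair r (chshTriangle c) 0, outcomePair r (chshTriangle c) 1] =
        outcomePair r (chshTriangle c) := by funext k; fin_cases k <;> rfl
    have h1 : (d.map fun r => outcomePair r (chshTriangle c)).weights
        ![outcomePair r (chshTriangle c) 0, outcomePair r (chshTriangle c) 1] = 0 := h0
    classical
    have hmem := Finset.mem_image_of_mem (fun r => outcomePair r (chshTriangle c)) hr
    rw [← Finsupp.mapDomain_support_of_subsingletonAddUnits, Finsupp.mem_support_iff] at hmem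
    rw [e] at h1
    exact hmem h1
  obtain ⟨h1, h2, h3, h4⟩ := outcomePair_chsh_relations r
  have p1 := parity y0x0
  have p2 := parity y0x1
  have p3 := parity x0y1
  have p4 := parity x1y1
  rw [h1, h3] at p1
  rw [h2] at p2
  rw [h4] at p3
  revert p1 p2 p3 p4
  simp only [prParity]
  generalize outcomePair r (chshTriangle y0x1) 0 = a
  generalize outcomePair r (chshTriangle x0y1) 0 = b
  generalize outcomePair r (chshTriangle x1y1) 0 = c
  generalize outcomePair r (chshTriangle x1y1) 1 = d
  revert a b c d
  decide

/-! ### Descent of the Popescu–Rohrlich box to the punctured torus -/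

theorem exists_toRange_comp_eq {X X' Y : SSet.{0}} {f : X ⟶ X'} (p : X ⟶ Y)
    (h : ∀ n (s s' : X.obj n), f.app n s = f.app n s' → p.app n s = p.app n s') :
    ∃ p' : (SSet.Subcomplex.range f : SSet.{0}) ⟶ Y, SSet.Subcomplex.toRange f ≫ p' = p := by
  have surj (n) (x : (SSet.Subcomplex.range f : SSet.{0}).obj n) : ∃ s, f.app n s = x.1 := x.2
  choose e he using surj
  refine ⟨{ app n := ↾fun x => p.app n (e n x), naturality m n g := ?_ }, ?_⟩
  · ext x
    refine (h n _ (X.map g (e m x)) ?_).trans (NatTrans.naturality_apply p g (e m x))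
    rw [he, NatTrans.naturality_apply f g (e m x), he]
    rfl
  · ext n s
    exact h n _ _ (he n _)

/-- A function on the simplices of the torus that restricts to the box on the punctured torus. It is
not simplicial: the deterministic labels of the edges of `σ_+` are `1`, `0` on `d_2`, `d_0` and `0`
on `d_1`, which do not add up. Its existence only shows that `prBox` takes the same value on
simplices with the same image in the torus. -/
noncomputable def prTorusLabel (n : SimplexCategoryᵒᵖ) :
    torus.obj n → StdSimplex ℝ≥0 (Fin n.unop.len → ZMod 2) :=
  Quot.lift (fun s : TorusContext × (n.unop ⟶ ⦋2⦌) => match s.1 with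
    | chsh c => (distSpace (nerveZMod 2)).map s.2.op (parityDist (prParity c))
    | plus => StdSimplex.single fun k =>
        if ({s.2.toOrderHom k.castSucc, s.2.toOrderHom k.succ} : Finset (Fin 3)) = {0, 1}
        then 1 else 0
    | minus => StdSimplex.single 0) (by
    rintro _ _ ⟨_, (rfl | rfl | rfl | rfl | rfl | rfl | rfl | rfl | rfl), u, rfl, rfl⟩
    all_goals dsimp only
    · rw [map_comp_δ, map_comp_δ, δ_parityDist_eq ⟨y0x0, 0, x0y1, 2⟩ (by simp [chshRelations])]
    · rw [map_comp_δ, map_comp_δ, δ_parityDist_eq ⟨y0x1, 0, x1y1, 2⟩ (by simp [chshRelations])]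
    · rw [map_comp_δ, map_comp_δ, δ_parityDist_eq ⟨y0x0, 2, y0x1, 2⟩ (by simp [chshRelations])]
    · rw [map_comp_δ, map_comp_δ, δ_parityDist_eq ⟨x0y1, 0, x1y1, 0⟩ (by simp [chshRelations])]
    · rw [map_comp_δ, map_δ_one_parityDist]
      refine congrArg _ (funext fun k => ?_)
      have key : ∀ i j : Fin 2,
          (if ({Fin.succAbove 2 i, Fin.succAbove 2 j} : Finset (Fin 3)) = {0, 1} then 1 else 0) =
            if i = j then 0 else prParity y0x0 := by decide
      exact key _ _
    · rw [map_comp_δ, map_δ_one_parityDist]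
      refine congrArg _ (funext fun k => ?_)
      have key : ∀ i j : Fin 2,
          (if ({Fin.succAbove 0 i, Fin.succAbove 0 j} : Finset (Fin 3)) = {0, 1} then 1 else 0) =
            if i = j then 0 else prParity x1y1 := by decide
      exact key _ _
    · rw [map_comp_δ, map_δ_one_parityDist]
      exact congrArg _ (funext fun k => (ite_self _).symm)
    · rw [map_comp_δ, map_δ_one_parityDist]
      exact congrArg _ (funext fun k => (ite_self _).symm)
    · refine congrArg _ (funext fun k => ?_)
      have key : ∀ i j : Fin 2,
          (if ({Fin.succAbove 1 i, Fin.succAbove 1 j} : Finset (Fin 3)) = {0, 1} then 1 else 0) =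
            (0 : ZMod 2) := by decide
      exact key _ _)

theorem prTorusLabel_chshToTorus (n : SimplexCategoryᵒᵖ) (s : chshSpace.obj n) :
    prTorusLabel n (chshToTorus.app n s) = prBox.app n s := by
  induction s using Quot.ind with
  | mk s => rfl

theorem exists_prBox_puncturedTorus :
    ∃ p : SimplicialDist puncturedTorus (nerveZMod 2),
      SSet.Subcomplex.toRange chshToTorus ≫ p = prBox := by
  refine exists_toRange_comp_eq prBox fun n s s' h => ?_
  refine (prTorusLabel_chshToTorus n s).symm.trans (Eq.trans ?_ (prTorusLabel_chshToTorus n s'))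
  rw [h]

theorem mainTheorem5 :
    ((∀ p : SimplicialDist chshSpace (nerveZMod 2),
        ExtendsAlong chshToTorus p ↔ Noncontextual p) ∧
      (∃! p, IsPRBox chshTriangle p) ∧
      (∀ p, IsPRBox chshTriangle p → ¬ ExtendsAlong chshToTorus p ∧ Contextual p)) ∧
    ((∀ p : SimplicialDist puncturedTorus (nerveZMod 2),
        ExtendsAlong puncturedTorus.ι p ↔ Noncontextual p) ∧
      (∃! p, IsPRBox puncturedTriangle p) ∧
      (∀ p, IsPRBox puncturedTriangle p →
        ¬ ExtendsAlong puncturedTorus.ι p ∧ Contextual p)) := by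
  have punctured {p : SimplicialDist puncturedTorus (nerveZMod 2)} :
      IsPRBox puncturedTriangle p ↔
        IsPRBox chshTriangle (SSet.Subcomplex.toRange chshToTorus ≫ p) := Iff.rfl
  refine ⟨⟨extendsAlong_chshToTorus_iff,
    ⟨prBox, isPRBox_prBox, fun p hp => hp.unique isPRBox_prBox⟩,
    fun p hp => ⟨fun h => hp.contextual ((extendsAlong_chshToTorus_iff p).1 h), hp.contextual⟩⟩,
    extendsAlong_puncturedTorus_iff, ?_, fun p hp => ?_⟩
  · obtain ⟨p, hp⟩ := exists_prBox_puncturedTorus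
    have hpr : IsPRBox puncturedTriangle p := punctured.2 (hp ▸ isPRBox_prBox)
    exact ⟨p, hpr, fun p' hp' => (cancel_epi (SSet.Subcomplex.toRange chshToTorus)).1
      ((punctured.1 hp').unique (punctured.1 hpr))⟩
  · have hc : Contextual p := fun h => (punctured.1 hp).contextual (h.comp _)
    exact ⟨fun h => hc ((extendsAlong_puncturedTorus_iff p).1 h), hc⟩
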